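/- Let $G$ be a rigidity circuit, that is, a finite simple graph with at least one edge such that removing any single edge gives a Laman graph (a graph with $n$ vertices and exactly $2n-3$ edges in which every set of $k\ge 2$ vertices spans at most $2k-3$ edges). Let $G$ be given as a plane graph: a system of rotations (a counter-clockwise cyclic order of the edges at each vertex) of the connected graph $G$ whose facial structure is that of an embedding in the sphere, i.e. satisfies $|V|-|E|+|F|=2$, together with an arbitrary face $f_o$ prescribed as the outer face. The other faces are called interior. Let $v_0$ be an arbitrary prescribed vertex that is not incident to $f_o$. Let $H$ be the bipartite graph with sides $V\setminus\{v_0\}$ and $W$, where $W$ contains $d_f-3$ copies of each interior face $f$ and $d_{f_o}$ copies of $f_o$ ($d_f$ denotes the number of edges of the face $f$), and where a vertex is adjacent in $H$ to every copy of every face to which it is incident. Then: 1. $H$ has a perfect matching. 2. $G$ has a pointed-plus-one combinatorial pseudo-triangulation with outer face $f_o$ and non-pointed vertex $v_0$. That is, the angles of $G$ (pairs of consecutive edges at a vertex, each lying in one face) can be labeled big or small so that every interior face has exactly three small angles, all angles of the outer face are big, each vertex is incident to at most one big angle, every vertex of degree $2$ is incident to a big angle, and $v_0$ is the only vertex incident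 to no big angle. -/

import Mathlib

/-!
Plane graphs as rotation systems of genus zero with a chosen outer face, Laman graphs and
rigidity circuits by counts, combinatorial pseudo-triangulations, and the bipartite graph whose
perfect matchings describe the possible assignments of big angles.
-/

universe u

namespace PseudoTri

/-! ### Laman graphs and rigidity circuits -/

section Rigidity

variable {V : Type u}

/-- The edges of `G` spanned by a set `S` of vertices. -/
def spannedEdges (G : SimpleGraph V) (S : Set V) : Set (Sym2 V) :=
  {e | e ∈ G.edgeSet ∧ ∀ v ∈ e, v ∈ S}

/-- `G` is a Laman graph: `m = 2 n - 3`, and every set of `k ≥ 2` vertices spans at most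
`2 k - 3` edges (both written without subtraction). -/
def IsLaman (G : SimpleGraph V) : Prop :=
  G.edgeSet.ncard + 3 = 2 * Nat.card V ∧
    ∀ S : Set V, 2 ≤ S.ncard → (spannedEdges G S).ncard + 3 ≤ 2 * S.ncard

/-- `G` is a rigidity circuit: it has an edge, and removing any edge gives a Laman graph. -/
def IsRigidityCircuit (G : SimpleGraph V) : Prop :=
  G.edgeSet.Nonempty ∧ ∀ e ∈ G.edgeSet, IsLaman (G.deleteEdges {e})

end Rigidity

/-! ### Rotation systems, faces, sphere embeddings -/

section Embedding

variable {V : Type u}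

/-- A system of rotations on `G`: for each vertex a cyclic (counter-clockwise) order of the edges
incident to it.  An edge incident to `v` is recorded as the dart (oriented edge) starting at `v`,
and `rot d` is the dart that follows `d` around its starting point `d.fst`. -/
structure RotationSystem (G : SimpleGraph V) where
  /-- the successor in counter-clockwise order around the starting point -/
  rot : Equiv.Perm G.Dart
  rot_fst : ∀ d : G.Dart, (rot d).fst = d.fst
  rot_sameCycle : ∀ d d' : G.Dart, d.fst = d'.fst → rot.SameCycle d d'

namespace RotationSystem

variable {G : SimpleGraph V} (R : RotationSystem G)

/-- The next dart along the boundary of the face on the left of a dart `u → v`: the one that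
precedes `v → u` in the counter-clockwise order around `v`. -/
def facePerm : Equiv.Perm G.Dart :=
  R.rot⁻¹ * (SimpleGraph.Dart.symm_involutive (G := G)).toPerm

/-- The faces: the orbits of the face-tracing permutation. -/
def Face : Type u := Quotient (Equiv.Perm.SameCycle.setoid R.facePerm)

/-- The face on the left of a dart.  An angle is a pair `(d, rot d)` of consecutive edges at a
vertex; it is represented by its first dart `d`.  It lies at the vertex `d.fst` and in the face
`R.face d`. -/
def face (d : G.Dart) : R.Face := Quotient.mk _ d

/-- The degree of a face: the length of its boundary walk. -/
noncomputable def faceDegree (f : R.Face) : ℕ := {d : G.Dart | R.face d = f}.ncard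

/-- The vertex `v` belongs to the face `f`. -/
def Incident (v : V) (f : R.Face) : Prop := ∃ d : G.Dart, d.fst = v ∧ R.face d = f

end RotationSystem

/-- A sphere embedding of a connected graph: a system of rotations of genus zero, that is, one
whose facial structure satisfies Euler's relation `|V| - |E| + |F| = 2`.  Together with the choice
of a face as the outer face it is a plane graph. -/
structure SphereEmbedding (G : SimpleGraph V) extends RotationSystem G where
  connected : G.Connected
  euler : Nat.card V + Nat.card toRotationSystem.Face = G.edgeSet.ncard + 2

end Embedding

/-! ### Combinatorial pseudo-triangulations -/

/-- The two labels of angles: big (reflex) and small (convex). -/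
inductive AngleLabel : Type
  | big
  | small

section CPT

variable {V : Type u} {G : SimpleGraph V}

/-- A vertex is pointed if it is incident to an angle labeled big. -/
def IsPointed (L : G.Dart → AngleLabel) (v : V) : Prop :=
  ∃ d : G.Dart, d.fst = v ∧ L d = AngleLabel.big

/-- The labeling `L` of the angles is a combinatorial pseudo-triangulation of the plane graph
given by `R` and the outer face `outer`. -/
structure IsCPT (R : RotationSystem G) (outer : R.Face) (L : G.Dart → AngleLabel) : Prop where
  /-- every face except the outer one has exactly three small angles -/
  three_corners : ∀ f : R.Face, f ≠ outer →
    {d : G.Dart | R.face d = f ∧ L d = AngleLabel.small}.ncard = 3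
  /-- all angles of the outer face are big -/
  outer_big : ∀ d : G.Dart, R.face d = outer → L d = AngleLabel.big
  /-- each vertex is incident to at most one big angle -/
  big_unique : ∀ d d' : G.Dart, d.fst = d'.fst →
    L d = AngleLabel.big → L d' = AngleLabel.big → d = d'
  /-- a vertex of degree two is incident to a big angle -/
  pointed_of_degree_two : ∀ v : V, (G.neighborSet v).ncard = 2 → IsPointed L v

/-- A combinatorial pseudo-triangulation is pointed-plus-one if exactly one vertex is
non-pointed. -/
def IsPointedPlusOneCPT (R : RotationSystem G) (outer : R.Face) (L : G.Dart → AngleLabel) :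
    Prop :=
  IsCPT R outer L ∧ ∃! v : V, ¬ IsPointed L v

/-! ### The associated bipartite graph -/

open Classical in
/-- The multiplicity of a face in `W`: its degree `d` for the outer face, and `d - 3` for an
interior face. -/
noncomputable def faceMultiplicity (R : RotationSystem G) (outer f : R.Face) : ℕ :=
  if f = outer then R.faceDegree f else R.faceDegree f - 3

/-- The side `W` of the bipartition: each face, taken with its multiplicity. -/
abbrev FaceCopy (R : RotationSystem G) (outer : R.Face) : Type u :=
  Σ f : R.Face, Fin (faceMultiplicity R outer f)

/-- The bipartite graph `H` with sides `V \ {v₀}` and `W`: a vertex is joined to all copies of the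
faces to which it belongs. -/
def bipartiteH (R : RotationSystem G) (outer : R.Face) (v₀ : V) :
    SimpleGraph ({v : V // v ≠ v₀} ⊕ FaceCopy R outer) where
  Adj
    | Sum.inl v, Sum.inr w => R.Incident v.1 w.1
    | Sum.inr w, Sum.inl v => R.Incident v.1 w.1
    | Sum.inl _, Sum.inl _ => False
    | Sum.inr _, Sum.inr _ => False
  symm := ⟨by rintro (_ | _) (_ | _) h <;> exact h⟩
  loopless := ⟨by rintro (_ | _) h <;> exact h⟩

end CPT

end PseudoTri

/-!
The matching comes from Hall's condition. Let `C` be a set of faces that is connected in the dual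
graph and misses a face, let `i` edges have both sides and `b` edges exactly one side in `C`, and
let `C` surround `s` vertices. In the space of functions on darts, coboundaries of vertex potentials
are orthogonal to coboundaries of face potentials on the sphere. Vertex potentials supported on the
surrounded vertices and face potentials supported on `C` and vanishing at one face of `C` are
therefore linearly independent on the `i` inner edges, so `s + |C| ≤ i + 1`. The edges of `C` span
at most `s + b` vertices, so the Laman count gives `i + b ≤ 2 (s + b) - 3`, unless `C` carries all
`2 |V| - 2` edges. Together these say `s ≤ (2 i + b) - 3 |C|`, and `2 i + b` is the number of angles
of `C`, of which all but three per interior face are offered to the matching. In the exceptional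
case the first inequality suffices, as `|F| = |V|` by Euler's relation and `v₀` is not on the outer
face. A set of vertices demands the faces around it, which split into dual-connected pieces. Calling
the matched angles big gives the pseudo-triangulation.
-/

namespace PseudoTri

open SimpleGraph

variable {V : Type u} {G : SimpleGraph V}

/-! ### Darts and edges -/

instance instFiniteDart [Finite V] : Finite G.Dart :=
  Finite.of_injective _ Dart.toProd_injective

theorem ncard_preimage_eq_sum_ncard_fiber {α β : Type*} [Finite α] (f : α → β) (C : Finset β) :
    (f ⁻¹' C).ncard = ∑ b ∈ C, (f ⁻¹' {b}).ncard := by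
  rw [← Set.biUnion_preimage_singleton, C.finite_toSet.ncard_biUnion (fun _ _ => Set.toFinite _)
    (Set.pairwiseDisjoint_fiber f C), ← finsum_mem_coe_finset]

theorem preimage_edge_singleton (d : G.Dart) : Dart.edge ⁻¹' {d.edge} = {d, d.symm} := by
  ext d'
  exact dart_edge_eq_iff d' d

theorem ncard_eq_two_mul_ncard_image_edge [Finite V] {D : Set G.Dart}
    (hD : ∀ d ∈ D, d.symm ∈ D) : D.ncard = 2 * (Dart.edge '' D).ncard := by
  obtain ⟨S, hS⟩ := (Set.toFinite (Dart.edge '' D)).exists_finset_coe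
  have hpre : D = Dart.edge ⁻¹' S := by
    refine (hS ▸ Set.subset_preimage_image Dart.edge D).antisymm fun d hd => ?_
    obtain ⟨d', hd', hedge⟩ : d.edge ∈ Dart.edge '' D := hS ▸ hd
    rcases (dart_edge_eq_iff _ _).1 hedge with rfl | rfl
    · exact hd'
    · exact d.symm_symm ▸ hD _ hd'
  have hfiber : ∀ e ∈ S, (Dart.edge ⁻¹' {e} : Set G.Dart).ncard = 2 := by
    intro e he
    obtain ⟨d, -, rfl⟩ : e ∈ Dart.edge '' D := hS ▸ he
    rw [preimage_edge_singleton, Set.ncard_pair d.symm_ne.symm]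
  rw [← hS, Set.ncard_coe_finset]
  conv_lhs => rw [hpre, ncard_preimage_eq_sum_ncard_fiber, Finset.sum_congr rfl hfiber]
  rw [Finset.sum_const, smul_eq_mul, mul_comm]

theorem image_edge_univ : Dart.edge '' (Set.univ : Set G.Dart) = G.edgeSet := by
  refine Set.Subset.antisymm (by rintro _ ⟨d, -, rfl⟩; exact d.edge_mem) fun e he => ?_
  induction e with
  | h v w => exact ⟨⟨(v, w), he⟩, trivial, rfl⟩

theorem ncard_dart_univ [Finite V] :
    (Set.univ : Set G.Dart).ncard = 2 * G.edgeSet.ncard := by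
  rw [ncard_eq_two_mul_ncard_image_edge (D := Set.univ) fun _ _ => Set.mem_univ _, image_edge_univ]

namespace RotationSystem

variable (R : RotationSystem G)

/-! ### Faces and rotations -/

instance instFiniteFace [Finite V] : Finite R.Face :=
  Quotient.finite (Equiv.Perm.SameCycle.setoid R.facePerm)

theorem face_surjective : Function.Surjective R.face := Quotient.exists_rep

theorem rot_facePerm (d : G.Dart) : R.rot (R.facePerm d) = d.symm :=
  R.rot.apply_symm_apply d.symm

theorem facePerm_fst (d : G.Dart) : (R.facePerm d).fst = d.snd := by
  rw [← R.rot_fst, rot_facePerm]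
  rfl

theorem face_facePerm (d : G.Dart) : R.face (R.facePerm d) = R.face d :=
  Quotient.sound (Equiv.Perm.sameCycle_apply_left.2 (Equiv.Perm.SameCycle.refl _ _))

theorem face_symm_rot (d : G.Dart) : R.face (R.rot d).symm = R.face d := by
  have hnext : R.facePerm (R.rot d).symm = d :=
    R.rot.injective ((R.rot_facePerm _).trans (Dart.symm_symm _))
  rw [← R.face_facePerm, hnext]

theorem face_rot_symm_apply (d : G.Dart) : R.face (R.rot.symm d) = R.face d.symm := by
  rw [← R.face_symm_rot, Equiv.apply_symm_apply]

theorem rot_induction [Finite V] {v : V} {P : G.Dart → Prop}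
    (hrot : ∀ d : G.Dart, d.fst = v → P d → P (R.rot d)) {d d' : G.Dart} (hd : d.fst = v)
    (hd' : d'.fst = v) (h : P d) : P d' := by
  obtain ⟨n, rfl⟩ := (R.rot_sameCycle d d' (hd.trans hd'.symm)).exists_nat_pow_eq
  clear hd'
  suffices ((R.rot ^ n) d).fst = v ∧ P ((R.rot ^ n) d) from this.2
  induction n with
  | zero => exact ⟨hd, h⟩
  | succ n ih =>
    rw [pow_succ', Equiv.Perm.mul_apply]
    exact ⟨(R.rot_fst _).trans ih.1, hrot _ ih.1 ih.2⟩

theorem facePerm_facePerm_ne [Finite V] {d : G.Dart} (hdeg : 2 ≤ (G.neighborSet d.snd).ncard) :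
    R.facePerm (R.facePerm d) ≠ d := by
  intro hreturn
  have hsnd : (R.facePerm d).snd = d.fst := by rw [← R.facePerm_fst, hreturn]
  have hsymm : R.facePerm d = d.symm := Dart.ext _ _ (Prod.ext (R.facePerm_fst d) hsnd)
  have hfix : R.rot d.symm = d.symm :=
    (congrArg R.rot hsymm).symm.trans (R.rot_facePerm d)
  have hneighbor : G.neighborSet d.snd ⊆ {d.fst} := fun w hw =>
    congrArg (fun e : G.Dart => e.snd) (R.rot_induction (v := d.snd) (P := (· = d.symm))
      (fun e _ he => by rw [he, hfix]) (d' := ⟨(d.snd, w), hw⟩) rfl rfl rfl)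
  have := (Set.ncard_le_ncard hneighbor).trans_eq (Set.ncard_singleton _)
  omega

theorem three_le_faceDegree [Finite V] (hdeg : ∀ v, 2 ≤ (G.neighborSet v).ncard) (f : R.Face) :
    3 ≤ R.faceDegree f := by
  obtain ⟨d, rfl⟩ := R.face_surjective f
  have hne : ∀ e : G.Dart, e ≠ R.facePerm e := fun e h =>
    e.fst_ne_snd ((congrArg (fun e : G.Dart => e.fst) h).trans (R.facePerm_fst e))
  have hthree : ({d, R.facePerm d, R.facePerm (R.facePerm d)} : Set G.Dart).ncard = 3 :=
    Set.ncard_eq_three.2 ⟨_, _, _, hne d, (R.facePerm_facePerm_ne (hdeg _)).symm, hne _, rfl⟩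
  rw [← hthree]
  refine Set.ncard_le_ncard ?_
  rintro e (rfl | rfl | rfl)
  · rfl
  · exact R.face_facePerm d
  · exact (R.face_facePerm _).trans (R.face_facePerm d)

/-! ### Regions of faces -/

/-- The darts both sides of which lie in the set `C` of faces. -/
def interiorDarts (C : Set R.Face) : Set G.Dart :=
  {d | R.face d ∈ C ∧ R.face d.symm ∈ C}

/-- The darts with a face of `C` on the left and a face outside `C` on the right. -/
def boundaryDarts (C : Set R.Face) : Set G.Dart :=
  {d | R.face d ∈ C ∧ R.face d.symm ∉ C}

/-- The edges both sides of which lie in `C`. -/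
def interiorEdges (C : Set R.Face) : Set (Sym2 V) := Dart.edge '' R.interiorDarts C

/-- The edges on the boundary of some face in `C`. -/
def edgesOf (C : Set R.Face) : Set (Sym2 V) := Dart.edge '' (R.face ⁻¹' C)

/-- The vertices surrounded by `C`: those all of whose faces lie in `C`, vacuously including the
isolated ones. -/
def interiorVerts (C : Set R.Face) : Set V := {v | ∀ d : G.Dart, d.fst = v → R.face d ∈ C}

/-- The vertices incident to some face in `C`. -/
def vertsOf (C : Set R.Face) : Set V := {v | ∃ f ∈ C, R.Incident v f}

variable {R} {C : Set R.Face}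

theorem symm_mem_interiorDarts {d : G.Dart} :
    d.symm ∈ R.interiorDarts C ↔ d ∈ R.interiorDarts C := by
  rw [interiorDarts, Set.mem_ofPred_eq, Set.mem_ofPred_eq, Dart.symm_symm, and_comm]

theorem mem_interiorDarts_of_fst_mem {d : G.Dart} (h : d.fst ∈ R.interiorVerts C) :
    d ∈ R.interiorDarts C :=
  ⟨h d rfl, R.face_rot_symm_apply d ▸
    h (R.rot.symm d) (by rw [← R.rot_fst, Equiv.apply_symm_apply])⟩

theorem mem_interiorDarts_of_snd_mem {d : G.Dart} (h : d.snd ∈ R.interiorVerts C) :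
    d ∈ R.interiorDarts C :=
  symm_mem_interiorDarts.1 (mem_interiorDarts_of_fst_mem (d := d.symm) h)

theorem exists_notMem_interiorVerts (hC : C ≠ Set.univ) : ∃ v, v ∉ R.interiorVerts C := by
  obtain ⟨f, hf⟩ := (Set.ne_univ_iff_exists_notMem C).1 hC
  obtain ⟨d, rfl⟩ := R.face_surjective f
  exact ⟨d.fst, fun h => hf (h d rfl)⟩

theorem edgesOf_subset_spannedEdges : R.edgesOf C ⊆ spannedEdges G (R.vertsOf C) := by
  rintro _ ⟨d, hd, rfl⟩
  refine ⟨d.edge_mem, fun v hv => ?_⟩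
  rcases Sym2.mem_iff.1 (show v ∈ s(d.fst, d.snd) from hv) with rfl | rfl
  · exact ⟨_, hd, d, rfl, rfl⟩
  · exact ⟨_, hd, R.facePerm d, R.facePerm_fst d, R.face_facePerm d⟩

theorem injOn_edge_boundaryDarts : Set.InjOn Dart.edge (R.boundaryDarts C) := by
  intro d hd d' hd' h
  refine ((dart_edge_eq_iff d d').1 h).resolve_right ?_
  rintro rfl
  exact hd'.2 hd.1

variable [Finite V]

theorem ncard_preimage_face :
    (R.face ⁻¹' C).ncard = 2 * (R.interiorEdges C).ncard + (R.boundaryDarts C).ncard := by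
  rw [interiorEdges, ← ncard_eq_two_mul_ncard_image_edge fun _ => symm_mem_interiorDarts.2]
  exact (Set.ncard_inter_add_ncard_sdiff_eq_ncard (R.face ⁻¹' C)
    {d : G.Dart | R.face d.symm ∈ C}).symm

theorem ncard_edgesOf :
    (R.edgesOf C).ncard = (R.interiorEdges C).ncard + (R.boundaryDarts C).ncard := by
  have hsplit : R.edgesOf C = R.interiorEdges C ∪ Dart.edge '' R.boundaryDarts C := by
    rw [interiorEdges, ← Set.image_union]
    exact congrArg _ (Set.inter_union_sdiff (R.face ⁻¹' C)
      {d : G.Dart | R.face d.symm ∈ C}).symm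
  have hdisj : Disjoint (R.interiorEdges C) (Dart.edge '' R.boundaryDarts C) := by
    rw [Set.disjoint_left]
    rintro _ ⟨d, hd, rfl⟩ ⟨d', hd', h⟩
    rcases (dart_edge_eq_iff _ _).1 h with rfl | rfl
    · exact hd'.2 hd.2
    · exact hd'.2 (d.symm_symm ▸ hd.1)
  rw [hsplit, Set.ncard_union_eq hdisj, injOn_edge_boundaryDarts.ncard_image]

theorem vertsOf_subset :
    R.vertsOf C ⊆ R.interiorVerts C ∪ (fun d : G.Dart => d.fst) '' R.boundaryDarts C := by
  rintro v ⟨_, hd, d, hdv, rfl⟩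
  by_contra hv
  rw [Set.mem_union, not_or] at hv
  obtain ⟨hinterior, hboundary⟩ := hv
  refine hinterior fun d' hd' => ?_
  by_contra hd'C
  refine R.rot_induction (P := fun e => R.face e ∉ C) (fun e he heC => ?_) hd' hdv hd'C hd
  intro hrot
  exact hboundary ⟨R.rot e, ⟨hrot, R.face_symm_rot e ▸ heC⟩, (R.rot_fst e).trans he⟩

theorem ncard_vertsOf_le :
    (R.vertsOf C).ncard ≤ (R.interiorVerts C).ncard + (R.boundaryDarts C).ncard :=
  (Set.ncard_le_ncard vertsOf_subset).trans <| (Set.ncard_union_le _ _).trans <|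
    Nat.add_le_add_left (Set.ncard_image_le (Set.toFinite _)) _

theorem two_le_ncard_vertsOf (hC : C.Nonempty) : 2 ≤ (R.vertsOf C).ncard := by
  obtain ⟨f, hf⟩ := hC
  obtain ⟨d, rfl⟩ := R.face_surjective f
  have hspan := (edgesOf_subset_spannedEdges (Set.mem_image_of_mem Dart.edge hf)).2
  rw [← Set.ncard_pair d.fst_ne_snd]
  exact Set.ncard_le_ncard (Set.pair_subset (hspan _ (Sym2.mem_mk_left _ _))
    (hspan _ (Sym2.mem_mk_right _ _)))

end RotationSystem

/-! ### Potentials -/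

/-- The coboundary of a potential on the vertices: its drop along each dart. -/
def vertexDiff (G : SimpleGraph V) : (V → ℝ) →ₗ[ℝ] G.Dart → ℝ :=
  LinearMap.funLeft ℝ ℝ (fun d : G.Dart => d.fst) - LinearMap.funLeft ℝ ℝ (fun d : G.Dart => d.snd)

theorem vertexDiff_apply (p : V → ℝ) (d : G.Dart) : vertexDiff G p d = p d.fst - p d.snd := rfl

theorem apply_eq_of_vertexDiff_eq_zero (hG : G.Preconnected) {p : V → ℝ}
    (hp : vertexDiff G p = 0) (v w : V) : p v = p w := by
  obtain ⟨walk⟩ := hG v w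
  induction walk with
  | nil => rfl
  | cons h _ ih => exact (sub_eq_zero.1 (congrFun hp ⟨(_, _), h⟩)).trans ih

namespace RotationSystem

/-- The coboundary of a potential on the faces in the dual graph: its drop across each dart, from
left to right. -/
def faceDiff (R : RotationSystem G) : (R.Face → ℝ) →ₗ[ℝ] G.Dart → ℝ :=
  LinearMap.funLeft ℝ ℝ R.face - LinearMap.funLeft ℝ ℝ (fun d : G.Dart => R.face d.symm)

/-- The set `C` of faces spans a connected subgraph of the dual graph, encoded as: no nonempty
proper subset of `C` is closed under crossing an edge within `C`. -/
def DualConnected (R : RotationSystem G) (C : Set R.Face) : Prop :=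
  ∀ A ⊆ C, A.Nonempty → (∀ d, R.face d ∈ A → R.face d.symm ∈ C → R.face d.symm ∈ A) → A = C

variable {R : RotationSystem G} {C : Set R.Face}

theorem faceDiff_apply (c : R.Face → ℝ) (d : G.Dart) :
    R.faceDiff c d = c (R.face d) - c (R.face d.symm) := rfl

theorem sum_fst_mul_face_symm [Fintype G.Dart] (p : V → ℝ) (c : R.Face → ℝ) :
    ∑ d : G.Dart, p d.fst * c (R.face d.symm) = ∑ d : G.Dart, p d.fst * c (R.face d) := by
  rw [← Equiv.sum_comp R.rot]
  simp only [R.rot_fst, R.face_symm_rot]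

theorem vertexDiff_dotProduct_faceDiff [Fintype G.Dart] (p : V → ℝ) (c : R.Face → ℝ) :
    vertexDiff G p ⬝ᵥ R.faceDiff c = 0 := by
  have hsymm :
      ∑ d : G.Dart, p d.snd * R.faceDiff c d = -∑ d : G.Dart, p d.fst * R.faceDiff c d := by
    rw [← Equiv.sum_comp (Dart.symm_involutive (G := G)).toPerm, ← Finset.sum_neg_distrib]
    refine Finset.sum_congr rfl fun d _ => ?_
    change p d.fst * (c (R.face d.symm) - c (R.face d.symm.symm)) = _
    rw [d.symm_symm, faceDiff_apply]
    ring
  have hfst : ∑ d : G.Dart, p d.fst * R.faceDiff c d = 0 := by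
    simp only [faceDiff_apply, mul_sub, Finset.sum_sub_distrib, sum_fst_mul_face_symm, sub_self]
  simp only [dotProduct, vertexDiff_apply, sub_mul, Finset.sum_sub_distrib, hsymm, hfst, neg_zero,
    sub_self]

theorem vertexDiff_eq_zero_of_add_faceDiff_eq_zero [Finite V] {p : V → ℝ} {c : R.Face → ℝ}
    (hp : ∀ v ∉ R.interiorVerts C, p v = 0)
    (h : ∀ d ∈ R.interiorDarts C, vertexDiff G p d + R.faceDiff c d = 0) :
    vertexDiff G p = 0 := by
  have := Fintype.ofFinite G.Dart
  have hoff : ∀ d ∉ R.interiorDarts C, vertexDiff G p d = 0 := fun d hd => by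
    rw [vertexDiff_apply, hp _ (mt mem_interiorDarts_of_fst_mem hd),
      hp _ (mt mem_interiorDarts_of_snd_mem hd), sub_self]
  have hdot : vertexDiff G p ⬝ᵥ (vertexDiff G p + R.faceDiff c) = 0 := by
    refine Finset.sum_eq_zero fun d _ => mul_eq_zero.2 ?_
    by_cases hd : d ∈ R.interiorDarts C
    · exact .inr (h d hd)
    · exact .inl (hoff d hd)
  rwa [dotProduct_add, vertexDiff_dotProduct_faceDiff, add_zero, dotProduct_self_eq_zero] at hdot

theorem DualConnected.eqOn_zero (hC : R.DualConnected C) {c : R.Face → ℝ} {f₀ : R.Face}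
    (hf₀ : f₀ ∈ C) (hc : c f₀ = 0) (h : ∀ d ∈ R.interiorDarts C, R.faceDiff c d = 0) :
    Set.EqOn c 0 C := by
  have hzero : {f ∈ C | c f = 0} = C := by
    refine hC _ (Set.sep_subset _ _) ⟨f₀, hf₀, hc⟩ fun d hd hsymm => ⟨hsymm, ?_⟩
    exact (sub_eq_zero.1 (h d ⟨hd.1, hsymm⟩)).symm.trans hd.2
  exact fun f hf => (hzero.symm ▸ hf : f ∈ {f ∈ C | c f = 0}).2

theorem DualConnected.eq_zero_and_eq_zero [Finite V] (hG : G.Preconnected)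
    (hC : R.DualConnected C) (hCu : C ≠ Set.univ) {f₀ : R.Face} (hf₀ : f₀ ∈ C)
    {p : V → ℝ} {c : R.Face → ℝ} (hp : ∀ v ∉ R.interiorVerts C, p v = 0)
    (hc : ∀ f ∉ C \ {f₀}, c f = 0)
    (h : ∀ d ∈ R.interiorDarts C, vertexDiff G p d + R.faceDiff c d = 0) : p = 0 ∧ c = 0 := by
  have hdiff := vertexDiff_eq_zero_of_add_faceDiff_eq_zero hp h
  obtain ⟨w, hw⟩ := exists_notMem_interiorVerts hCu
  refine ⟨funext fun v => (apply_eq_of_vertexDiff_eq_zero hG hdiff v w).trans (hp w hw), ?_⟩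
  have hcC : Set.EqOn c 0 C := by
    refine hC.eqOn_zero hf₀ (hc f₀ fun hf => hf.2 rfl) fun d hd => ?_
    simpa only [hdiff, Pi.zero_apply, zero_add] using h d hd
  funext f
  by_cases hf : f ∈ C
  · exact hcC hf
  · exact hc f fun hf' => hf hf'.1

theorem vertexDiff_add_faceDiff_symm (p : V → ℝ) (c : R.Face → ℝ) (d : G.Dart) :
    vertexDiff G p d.symm + R.faceDiff c d.symm = -(vertexDiff G p d + R.faceDiff c d) := by
  change p d.snd - p d.fst + (c (R.face d.symm) - c (R.face d.symm.symm)) = _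
  rw [d.symm_symm, vertexDiff_apply, faceDiff_apply]
  ring

theorem DualConnected.ncard_add_ncard_interiorVerts_le [Finite V] (hG : G.Preconnected)
    (hC : R.DualConnected C) (hne : C.Nonempty) (hCu : C ≠ Set.univ) :
    C.ncard + (R.interiorVerts C).ncard ≤ (R.interiorEdges C).ncard + 1 := by
  obtain ⟨f₀, hf₀⟩ := hne
  have := Fintype.ofFinite V
  have := Fintype.ofFinite R.Face
  choose δ _ hedge using fun e : R.interiorEdges C => e.2
  let Ψ := ((LinearMap.funLeft ℝ ℝ (Subtype.val : ↥(R.interiorVerts C)ᶜ → V)).prodMap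
    (LinearMap.funLeft ℝ ℝ (Subtype.val : ↥(C \ {f₀})ᶜ → R.Face))).prod
      ((LinearMap.funLeft ℝ ℝ δ).comp ((vertexDiff G).coprod R.faceDiff))
  have hΨ : Function.Injective Ψ := by
    refine (injective_iff_map_eq_zero Ψ).2 fun ⟨p, c⟩ h => ?_
    obtain ⟨hpc, hdarts⟩ := Prod.mk.inj h
    obtain ⟨hp, hc⟩ := Prod.mk.inj hpc
    refine Prod.mk.injEq .. ▸ hC.eq_zero_and_eq_zero hG hCu hf₀ (fun v hv => congrFun hp ⟨v, hv⟩)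
      (fun f hf => congrFun hc ⟨f, hf⟩) fun d hd => ?_
    have hδd := congrFun hdarts ⟨d.edge, d, hd, rfl⟩
    change vertexDiff G p (δ _) + R.faceDiff c (δ _) = 0 at hδd
    rcases (dart_edge_eq_iff _ _).1 (hedge ⟨d.edge, d, hd, rfl⟩) with heq | heq
    · rwa [heq] at hδd
    · rwa [heq, vertexDiff_add_faceDiff_symm, neg_eq_zero] at hδd
  have hrank := LinearMap.finrank_le_finrank_of_injective hΨ
  have := Fintype.ofFinite (R.interiorEdges C)
  have := Fintype.ofFinite ↥(R.interiorVerts C)ᶜ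
  have := Fintype.ofFinite ↥(C \ {f₀})ᶜ
  simp only [Module.finrank_prod, Module.finrank_fintype_fun_eq_card, ← Nat.card_eq_fintype_card,
    Nat.card_coe_set_eq] at hrank
  have hI := Set.ncard_add_ncard_compl (R.interiorVerts C)
  have hC₀ := Set.ncard_add_ncard_compl (C \ {f₀})
  have hsdiff := Set.ncard_sdiff_singleton_add_one hf₀
  omega

end RotationSystem

/-! ### Rigidity circuits -/

namespace IsRigidityCircuit

variable [Finite V]

theorem ncard_edgeSet_add_two (hG : IsRigidityCircuit G) :
    G.edgeSet.ncard + 2 = 2 * Nat.card V := by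
  obtain ⟨e, he⟩ := hG.1
  have hlaman := (hG.2 e he).1
  rw [edgeSet_deleteEdges] at hlaman
  have := Set.ncard_sdiff_singleton_add_one he
  omega

theorem ncard_add_three_le_of_ssubset (hG : IsRigidityCircuit G) {T : Set (Sym2 V)} {S : Set V}
    (hT : T ⊂ G.edgeSet) (hTS : T ⊆ spannedEdges G S) (hS : 2 ≤ S.ncard) :
    T.ncard + 3 ≤ 2 * S.ncard := by
  obtain ⟨e, he, heT⟩ := Set.exists_of_ssubset hT
  refine le_trans (Nat.add_le_add_right (Set.ncard_le_ncard fun e' he' => ?_) 3)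
    ((hG.2 e he).2 S hS)
  refine ⟨?_, (hTS he').2⟩
  rw [edgeSet_deleteEdges]
  exact ⟨(hTS he').1, fun h => heT (h ▸ he')⟩

theorem three_le_card (hG : IsRigidityCircuit G) : 3 ≤ Nat.card V := by
  classical
  have := Fintype.ofFinite V
  have hedges := hG.ncard_edgeSet_add_two
  have hpos := (Set.ncard_pos (Set.toFinite _)).2 hG.1
  have hchoose := G.card_edgeFinset_le_card_choose_two
  rw [edgeFinset, ← Set.ncard_eq_toFinset_card', ← Nat.card_eq_fintype_card] at hchoose
  by_contra! hlt
  have htwo : Nat.card V = 2 := by omega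
  rw [htwo, Nat.choose_self] at hchoose
  omega

theorem three_le_ncard_neighborSet (hG : IsRigidityCircuit G) (v : V) :
    3 ≤ (G.neighborSet v).ncard := by
  have hedges := hG.ncard_edgeSet_add_two
  have hcard := hG.three_le_card
  have hcompl : ({v}ᶜ : Set V).ncard = Nat.card V - 1 := by
    rw [Set.ncard_compl, Set.ncard_singleton]
  have hsplit : G.edgeSet ⊆ spannedEdges G {v}ᶜ ∪ G.incidenceSet v := fun e he => by
    by_cases hv : v ∈ e
    · exact .inr ⟨he, hv⟩
    · exact .inl ⟨he, fun w hw h => hv (h ▸ hw)⟩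
  have hincidence : (G.incidenceSet v).ncard = (G.neighborSet v).ncard := by
    classical exact Nat.card_congr (G.incidenceSetEquivNeighborSet v)
  have hle := (Set.ncard_le_ncard hsplit).trans (Set.ncard_union_le _ _)
  have hne : spannedEdges G {v}ᶜ ≠ G.edgeSet := fun heq => by
    obtain ⟨e, he⟩ := hG.1
    have hsparse := hG.ncard_add_three_le_of_ssubset (Set.sdiff_singleton_ssubset.2 he)
      (heq.symm ▸ Set.sdiff_subset) (show 2 ≤ ({v}ᶜ : Set V).ncard by omega)
    have := Set.ncard_sdiff_singleton_add_one he
    omega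
  have hspan := hG.ncard_add_three_le_of_ssubset (S := {v}ᶜ)
    (Set.ssubset_iff_subset_ne.2 ⟨fun e he => he.1, hne⟩) subset_rfl (by omega)
  omega

theorem exists_dart_fst_eq (hG : IsRigidityCircuit G) (v : V) : ∃ d : G.Dart, d.fst = v := by
  obtain ⟨w, hw⟩ := Set.nonempty_of_ncard_ne_zero (s := G.neighborSet v)
    (by have := hG.three_le_ncard_neighborSet v; omega)
  exact ⟨⟨(v, w), hw⟩, rfl⟩

theorem three_le_faceDegree (hG : IsRigidityCircuit G) (R : RotationSystem G) (f : R.Face) :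
    3 ≤ R.faceDegree f :=
  R.three_le_faceDegree (fun v => by have := hG.three_le_ncard_neighborSet v; omega) f

end IsRigidityCircuit

namespace RotationSystem

variable {R : RotationSystem G} {C : Set R.Face}

theorem edgesOf_univ : R.edgesOf Set.univ = G.edgeSet := image_edge_univ

theorem edgesOf_subset_edgeSet : R.edgesOf C ⊆ G.edgeSet :=
  fun _ he => (edgesOf_subset_spannedEdges he).1

theorem DualConnected.ncard_interiorVerts_add_le_of_edgesOf_ne [Finite V] (hC : R.DualConnected C)
    (hG : IsRigidityCircuit G) (hconn : G.Preconnected) (hne : C.Nonempty)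
    (hE : R.edgesOf C ≠ G.edgeSet) :
    (R.interiorVerts C).ncard + 3 * C.ncard ≤ (R.face ⁻¹' C).ncard := by
  have hCu : C ≠ Set.univ := fun h => hE (h ▸ edgesOf_univ)
  have hrank := hC.ncard_add_ncard_interiorVerts_le hconn hne hCu
  have hsparse := hG.ncard_add_three_le_of_ssubset (edgesOf_subset_edgeSet.ssubset_of_ne hE)
    edgesOf_subset_spannedEdges (two_le_ncard_vertsOf hne)
  have hverts := R.ncard_vertsOf_le (C := C)
  rw [ncard_edgesOf] at hsparse
  rw [ncard_preimage_face]
  omega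

theorem DualConnected.ncard_interiorVerts_add_le_of_edgesOf_eq [Finite V] (hC : R.DualConnected C)
    (hG : IsRigidityCircuit G) (hconn : G.Preconnected) (hne : C.Nonempty) (hCu : C ≠ Set.univ)
    (hE : R.edgesOf C = G.edgeSet) :
    (R.interiorVerts C).ncard + C.ncard + 2 * Nat.card V ≤ (R.face ⁻¹' C).ncard + 3 := by
  have hrank := hC.ncard_add_ncard_interiorVerts_le hconn hne hCu
  have hedges := hG.ncard_edgeSet_add_two
  rw [← hE, ncard_edgesOf] at hedges
  rw [ncard_preimage_face]
  omega

theorem induction_on_dualConnected [Finite V] {P : Set R.Face → Prop} (hempty : P ∅)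
    (hconn : ∀ C : Set R.Face, C.Nonempty → R.DualConnected C → P C)
    (hunion : ∀ A B : Set R.Face, Disjoint A B → (∀ d, R.face d ∈ A → R.face d.symm ∉ B) →
      P A → P B → P (A ∪ B)) (N : Set R.Face) : P N := by
  induction N using WellFoundedLT.induction with
  | ind N ih =>
    rcases N.eq_empty_or_nonempty with rfl | hne
    · exact hempty
    by_cases hN : R.DualConnected N
    · exact hconn N hne hN
    unfold DualConnected at hN
    push Not at hN
    obtain ⟨A, hAN, hA, hclosed, hAne⟩ := hN
    rw [← Set.union_sdiff_cancel hAN]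
    refine hunion A (N \ A) Set.disjoint_sdiff_right
      (fun d hd hsymm => hsymm.2 (hclosed d hd hsymm.1)) (ih A (hAN.ssubset_of_ne hAne))
      (ih _ (sdiff_lt hAN hA.ne_empty))

theorem interiorVerts_union_subset [Finite V] {A B : Set R.Face}
    (hAB : ∀ d, R.face d ∈ A → R.face d.symm ∉ B) :
    R.interiorVerts (A ∪ B) ⊆ R.interiorVerts A ∪ R.interiorVerts B := by
  refine fun v hv => or_iff_not_imp_left.2 fun hvA => ?_
  obtain ⟨d, hd, hdA⟩ : ∃ d : G.Dart, d.fst = v ∧ R.face d ∉ A := by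
    simpa only [interiorVerts, Set.mem_ofPred_eq, not_forall, exists_prop] using hvA
  refine fun d' hd' => R.rot_induction (P := fun e => R.face e ∈ B) (fun e he heB => ?_) hd hd'
    ((hv d hd).resolve_left hdA)
  refine (hv (R.rot e) ((R.rot_fst e).trans he)).resolve_left fun hrotA => ?_
  exact hAB _ hrotA ((R.face_symm_rot e).symm ▸ heB)

end RotationSystem

/-! ### Face copies and Hall's condition -/

section FaceCopies

variable {R : RotationSystem G} {outer : R.Face}

theorem ncard_preimage_fst_singleton (f : R.Face) :
    (Sigma.fst ⁻¹' {f} : Set (FaceCopy R outer)).ncard = faceMultiplicity R outer f := by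
  rw [← Set.range_sigmaMk, ← Set.image_univ, Set.ncard_image_of_injective _ sigma_mk_injective,
    Set.ncard_univ, Nat.card_fin]

open Classical in
theorem faceMultiplicity_add_three {f : R.Face} (hf : 3 ≤ R.faceDegree f) :
    faceMultiplicity R outer f + 3 = R.faceDegree f + if f = outer then 3 else 0 := by
  unfold faceMultiplicity
  split_ifs <;> omega

open Classical in
theorem ncard_preimage_fst_add [Finite V] (hdeg : ∀ f, 3 ≤ R.faceDegree f) (C : Set R.Face) :
    (Sigma.fst ⁻¹' C : Set (FaceCopy R outer)).ncard + 3 * C.ncard =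
      (R.face ⁻¹' C).ncard + if outer ∈ C then 3 else 0 := by
  lift C to Finset R.Face using C.toFinite
  have hfiber : ∀ f, (R.face ⁻¹' {f}).ncard = R.faceDegree f := fun _ => rfl
  simp only [ncard_preimage_eq_sum_ncard_fiber, ncard_preimage_fst_singleton, hfiber,
    Set.ncard_coe_finset, mul_comm 3, ← smul_eq_mul, ← Finset.sum_const, ← Finset.sum_add_distrib,
    faceMultiplicity_add_three (hdeg _), Finset.mem_coe]
  rw [Finset.sum_add_distrib, Finset.sum_ite_eq']

end FaceCopies

namespace SphereEmbedding

variable [Finite V] {M : SphereEmbedding G} {outer : M.Face} {v₀ : V}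

theorem card_face_eq_card (M : SphereEmbedding G) (hG : IsRigidityCircuit G) :
    Nat.card M.Face = Nat.card V := by
  have := M.euler
  have := hG.ncard_edgeSet_add_two
  omega

theorem card_faceCopy_add_one (hG : IsRigidityCircuit G) :
    Nat.card (FaceCopy M.toRotationSystem outer) + 1 = Nat.card V := by
  have hcopies := ncard_preimage_fst_add (outer := outer)
    (hG.three_le_faceDegree M.toRotationSystem) Set.univ
  rw [Set.preimage_univ, Set.preimage_univ, if_pos (Set.mem_univ _), ncard_dart_univ,
    Set.ncard_univ, Set.ncard_univ, M.card_face_eq_card hG] at hcopies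
  have := hG.ncard_edgeSet_add_two
  omega

theorem ncard_interiorVerts_sdiff_le_of_edgesOf_eq (hG : IsRigidityCircuit G)
    (hv₀ : ¬ M.Incident v₀ outer) {C : Set M.Face} (hne : C.Nonempty) (hC : M.DualConnected C)
    (hCu : C ≠ Set.univ) (hE : M.edgesOf C = G.edgeSet) :
    (M.interiorVerts C \ {v₀}).ncard ≤
      (Sigma.fst ⁻¹' C : Set (FaceCopy M.toRotationSystem outer)).ncard := by
  have hsub : (M.interiorVerts C \ {v₀}).ncard ≤ (M.interiorVerts C).ncard :=
    Set.ncard_le_ncard Set.sdiff_subset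
  have hcopies := ncard_preimage_fst_add (outer := outer)
    (hG.three_le_faceDegree M.toRotationSystem) C
  have hfull := hC.ncard_interiorVerts_add_le_of_edgesOf_eq hG M.connected.preconnected hne hCu hE
  have hcompl := Set.ncard_add_ncard_compl C
  rw [M.card_face_eq_card hG] at hcompl
  by_cases houter : outer ∈ C
  · rw [if_pos houter] at hcopies
    omega
  rw [if_neg houter] at hcopies
  -- One copy may be lacking: either `C` surrounds `v₀`, or it misses a second face at `v₀`.
  by_cases hv₀C : v₀ ∈ M.interiorVerts C
  · have := Set.ncard_sdiff_singleton_add_one hv₀C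
    have : 0 < Cᶜ.ncard := (Set.ncard_pos).2 ⟨outer, houter⟩
    omega
  · obtain ⟨d, hd, hdC⟩ : ∃ d : G.Dart, d.fst = v₀ ∧ M.face d ∉ C := by
      simpa only [RotationSystem.interiorVerts, Set.mem_ofPred_eq, not_forall, exists_prop]
        using hv₀C
    have hpair : ({M.face d, outer} : Set M.Face) ⊆ Cᶜ := Set.pair_subset hdC houter
    have := Set.ncard_le_ncard hpair
    rw [Set.ncard_pair fun h => hv₀ ⟨d, hd, h⟩] at this
    omega

theorem ncard_interiorVerts_sdiff_le_of_dualConnected (hG : IsRigidityCircuit G)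
    (hv₀ : ¬ M.Incident v₀ outer) {C : Set M.Face} (hne : C.Nonempty) (hC : M.DualConnected C) :
    (M.interiorVerts C \ {v₀}).ncard ≤
      (Sigma.fst ⁻¹' C : Set (FaceCopy M.toRotationSystem outer)).ncard := by
  rcases eq_or_ne C Set.univ with rfl | hCu
  · have hcopies := M.card_faceCopy_add_one (outer := outer) hG
    have hcompl := Set.ncard_add_ncard_compl {v₀}
    have : (M.interiorVerts Set.univ \ {v₀}).ncard ≤ ({v₀}ᶜ : Set V).ncard :=
      Set.ncard_le_ncard fun v hv => hv.2
    rw [Set.ncard_singleton] at hcompl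
    rw [Set.preimage_univ, Set.ncard_univ]
    omega
  by_cases hE : M.edgesOf C = G.edgeSet
  · exact ncard_interiorVerts_sdiff_le_of_edgesOf_eq hG hv₀ hne hC hCu hE
  · have hcopies := ncard_preimage_fst_add (outer := outer)
      (hG.three_le_faceDegree M.toRotationSystem) C
    have hle := hC.ncard_interiorVerts_add_le_of_edgesOf_ne hG M.connected.preconnected hne hE
    have : (M.interiorVerts C \ {v₀}).ncard ≤ (M.interiorVerts C).ncard :=
      Set.ncard_le_ncard Set.sdiff_subset
    omega

theorem ncard_interiorVerts_sdiff_le (hG : IsRigidityCircuit G) (hv₀ : ¬ M.Incident v₀ outer)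
    (N : Set M.Face) :
    (M.interiorVerts N \ {v₀}).ncard ≤
      (Sigma.fst ⁻¹' N : Set (FaceCopy M.toRotationSystem outer)).ncard := by
  induction N using RotationSystem.induction_on_dualConnected with
  | hempty =>
    have hinterior : M.interiorVerts ∅ = ∅ := Set.eq_empty_of_forall_notMem fun v hv => by
      obtain ⟨d, hd⟩ := hG.exists_dart_fst_eq v
      exact hv d hd
    rw [hinterior, Set.empty_sdiff, Set.ncard_empty]
    exact Nat.zero_le _
  | hconn C hne hC => exact ncard_interiorVerts_sdiff_le_of_dualConnected hG hv₀ hne hC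
  | hunion A B hdisj hAB hA hB =>
    rw [Set.preimage_union, Set.ncard_union_eq (hdisj.preimage _)]
    refine le_trans (Set.ncard_le_ncard ?_) ((Set.ncard_union_le _ _).trans (Nat.add_le_add hA hB))
    rw [← Set.union_sdiff_distrib]
    exact Set.sdiff_subset_sdiff_left (RotationSystem.interiorVerts_union_subset hAB)

theorem exists_bijective_incident (hG : IsRigidityCircuit G) (hv₀ : ¬ M.Incident v₀ outer) :
    ∃ φ : {v : V // v ≠ v₀} → FaceCopy M.toRotationSystem outer,
      Function.Bijective φ ∧ ∀ v, M.Incident v.1 (φ v).1 := by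
  classical
  have := Fintype.ofFinite (FaceCopy M.toRotationSystem outer)
  obtain ⟨φ, hφ, hinc⟩ := (Fintype.all_card_le_filter_rel_iff_exists_injective
    fun (v : {v : V // v ≠ v₀}) (w : FaceCopy M.toRotationSystem outer) =>
      M.Incident v w.1).1 fun S => by
    let N : Set M.Face := {f | ∃ v ∈ S, M.Incident v.1 f}
    have hS : (Subtype.val '' (S : Set {v : V // v ≠ v₀})) ⊆ M.interiorVerts N \ {v₀} := by
      rintro _ ⟨v, hv, rfl⟩
      exact ⟨fun d hd => ⟨v, hv, d, hd, rfl⟩, v.2⟩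
    have hle := (Set.ncard_le_ncard hS).trans (ncard_interiorVerts_sdiff_le hG hv₀ N)
    rw [Set.ncard_image_of_injective _ Subtype.val_injective, Set.ncard_coe_finset] at hle
    rw [← Set.ncard_coe_finset {w | _}, Finset.coe_filter_univ]
    exact hle
  refine ⟨φ, hφ.bijective_of_nat_card_le ?_, hinc⟩
  have hcopies := M.card_faceCopy_add_one (outer := outer) hG
  have hverts : Nat.card {v : V // v ≠ v₀} = Nat.card V - 1 := by
    rw [← Set.ncard_singleton v₀, ← Set.ncard_compl]
    rfl
  omega

end SphereEmbedding

/-! ### Matchings and labelings -/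

theorem exists_isPerfectMatching_of_bijective {α β : Type*} {H : SimpleGraph (α ⊕ β)}
    {φ : α → β} (hφ : Function.Bijective φ) (hadj : ∀ a, H.Adj (Sum.inl a) (Sum.inr (φ a))) :
    ∃ P : H.Subgraph, P.IsPerfectMatching := by
  let f : Set.range (Sum.inl : α → α ⊕ β) ≃ Set.range (Sum.inr : β → α ⊕ β) :=
    ((Equiv.ofInjective _ Sum.inl_injective).symm.trans (Equiv.ofBijective φ hφ)).trans
      (Equiv.ofInjective _ Sum.inr_injective)
  obtain ⟨P, hverts, hP⟩ := Subgraph.IsMatching.exists_of_disjoint_sets_of_equiv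
    Set.isCompl_range_inl_range_inr.disjoint f (G := H) (by
      rintro ⟨_, a, rfl⟩
      simpa [f] using hadj a)
  refine ⟨P, hP, Subgraph.isSpanning_iff.2 ?_⟩
  rw [hverts, Set.range_inl_union_range_inr]

section Labeling

variable {R : RotationSystem G} {outer : R.Face} {B : Set G.Dart}

open Classical in
/-- The labeling of the angles in which exactly the angles in `B` are big. -/
noncomputable def bigOn (B : Set G.Dart) (d : G.Dart) : AngleLabel :=
  if d ∈ B then .big else .small

theorem bigOn_eq_big {d : G.Dart} : bigOn B d = .big ↔ d ∈ B := by
  simp [bigOn]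

theorem bigOn_eq_small {d : G.Dart} : bigOn B d = .small ↔ d ∉ B := by
  simp [bigOn]

theorem isPointed_bigOn {v : V} : IsPointed (bigOn B) v ↔ ∃ d ∈ B, d.fst = v := by
  simp only [IsPointed, bigOn_eq_big, and_comm]

theorem isCPT_bigOn [Finite V] (hdeg : ∀ f, 3 ≤ R.faceDegree f)
    (hv : ∀ v, (G.neighborSet v).ncard ≠ 2) (hB : Set.InjOn (fun d : G.Dart => d.fst) B)
    (hcount : ∀ f, (R.face ⁻¹' {f} ∩ B).ncard = faceMultiplicity R outer f) :
    IsCPT R outer (bigOn B) := by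
  have hsmall : ∀ f, faceMultiplicity R outer f + (R.face ⁻¹' {f} \ B).ncard = R.faceDegree f :=
    fun f => hcount f ▸ Set.ncard_inter_add_ncard_sdiff_eq_ncard (R.face ⁻¹' {f}) B
  refine ⟨fun f hf => ?_, fun d hd => ?_,
    fun d d' h hd hd' => hB (bigOn_eq_big.1 hd) (bigOn_eq_big.1 hd') h,
    fun v h => absurd h (hv v)⟩
  · have hsplit := hsmall f
    have := hdeg f
    simp only [bigOn_eq_small]
    change (R.face ⁻¹' {f} \ B).ncard = 3
    rw [faceMultiplicity, if_neg hf] at hsplit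
    omega
  · have hsplit := hsmall outer
    rw [faceMultiplicity, if_pos rfl, Nat.add_eq_left, Set.ncard_eq_zero, Set.sdiff_eq_empty]
      at hsplit
    exact bigOn_eq_big.2 (hsplit hd)

theorem exists_isPointedPlusOneCPT_of_bijective [Finite V] {v₀ : V}
    (hdeg : ∀ f, 3 ≤ R.faceDegree f) (hv : ∀ v, (G.neighborSet v).ncard ≠ 2)
    {φ : {v : V // v ≠ v₀} → FaceCopy R outer} (hφ : Function.Bijective φ)
    (hinc : ∀ v, R.Incident v.1 (φ v).1) :
    ∃ L : G.Dart → AngleLabel, IsPointedPlusOneCPT R outer L ∧ ¬ IsPointed L v₀ := by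
  choose δ hδ hface using hinc
  have hfst : Function.Injective ((fun d : G.Dart => d.fst) ∘ δ) :=
    fun v w h => Subtype.ext ((hδ v).symm.trans (h.trans (hδ w)))
  have hcount : ∀ f, (R.face ⁻¹' {f} ∩ Set.range δ).ncard = faceMultiplicity R outer f := by
    intro f
    have himage : R.face ⁻¹' {f} ∩ Set.range δ = δ '' (φ ⁻¹' (Sigma.fst ⁻¹' {f})) := by
      rw [← Set.image_preimage_eq_inter_range, ← Set.preimage_comp, ← Set.preimage_comp]
      exact congrArg (fun g => δ '' (g ⁻¹' {f})) (funext hface)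
    rw [himage, Set.ncard_image_of_injective _ hfst.of_comp,
      Set.ncard_preimage_of_injective_subset_range hφ.1 (hφ.2.range_eq ▸ Set.subset_univ _),
      ncard_preimage_fst_singleton]
  have hpointed : ∀ v, ¬ IsPointed (bigOn (Set.range δ)) v ↔ v = v₀ := fun v => by
    rw [isPointed_bigOn, Set.exists_range_iff, not_iff_comm]
    exact ⟨fun hne => ⟨⟨v, hne⟩, hδ _⟩, fun ⟨w, hw⟩ => hw ▸ (hδ w).symm ▸ w.2⟩
  exact ⟨bigOn (Set.range δ), ⟨isCPT_bigOn hdeg hv hfst.injOn_range hcount, v₀,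
    (hpointed v₀).2 rfl, fun v => (hpointed v).1⟩, (hpointed v₀).2 rfl⟩

end Labeling

end PseudoTri

theorem mainTheorem9 {V : Type u} [Finite V] (G : SimpleGraph V)
    (hG : PseudoTri.IsRigidityCircuit G) (M : PseudoTri.SphereEmbedding G)
    (outer : M.toRotationSystem.Face) (v₀ : V)
    (hv₀ : ¬ M.toRotationSystem.Incident v₀ outer) :
    (∃ P : (PseudoTri.bipartiteH M.toRotationSystem outer v₀).Subgraph, P.IsPerfectMatching) ∧
      ∃ L : G.Dart → PseudoTri.AngleLabel,
        PseudoTri.IsPointedPlusOneCPT M.toRotationSystem outer L ∧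
          ¬ PseudoTri.IsPointed L v₀ := by
  obtain ⟨φ, hφ, hinc⟩ := PseudoTri.SphereEmbedding.exists_bijective_incident hG hv₀
  refine ⟨PseudoTri.exists_isPerfectMatching_of_bijective hφ hinc,
    PseudoTri.exists_isPointedPlusOneCPT_of_bijective (hG.three_le_faceDegree _) (fun v => ?_)
      hφ hinc⟩
  have := hG.three_le_ncard_neighborSet v
  omega
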